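/- There are absolute constants $a, b > 0$ with the following property. For all positive real numbers $\mu, \nu < \frac13$ there are a compact hypersurface without boundary $M \subset \mathbb{R}^4$ (a $C^1$ embedded hypersurface) of positive finite reach $\mathrm{rch}(M)$ and a finite set $L \subset M$ such that, with $\varepsilon = \mu\,\mathrm{rch}(M)$ and $\delta = \nu\,\mathrm{rch}(M)$, the set $L$ is an $(a\varepsilon)$-sparse $(b\varepsilon)$-sample of $M$ and, for every $\eta > 0$, there exist both a finite set $W \subset M$ and an infinite set $W \subset M$, each of which is a $\delta$-sample and an $\eta$-sample of $M$, such that the witness complex of $L$ relative to $W$ is not contained in the restricted Delaunay triangulation $\mathrm{Del}_{|M}(L)$. Here $\mathrm{rch}(M)$ is the infimum over $x \in M$ of the distance from $x$ to the medial axis of $M$, the closure of the set of points of $\mathbb{R}^4$ with at least two nearest points on $M$. A set $S \subset M$ is an $r$-sample of $M$ if every point of $M$ is at Euclidean distance at most $r$ from $S$, and $S$ is $r$-sparse if distinct points of $S$ are at distance at least $r$. $\mathrm{Del}_{|M}(L)$ is the nerve of the cover of $M$ by the sets $V(p) \cap M$, $p \in L$, where $V(p) = \{x : \|x-p\| \le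 \|x-q\| \text{ for all } q \in L\}$ is the Voronoi cell of $p$. A point $w$ witnesses a nonempty set $\sigma \subset L$ if $\|w-p\| \le \|w-q\|$ for all $p \in \sigma$ and all $q \in L \setminus \sigma$; the witness complex of $L$ relative to $W$ is the largest abstract simplicial complex with vertices in $L$ all of whose simplices are witnessed by points of $W$. -/

import Mathlib

open Set
open scoped ENNReal

noncomputable section

/-- `M ⊆ ℝⁿ` is an embedded hypersurface without boundary of class `C¹`: locally it is the zero set
of a `C¹` function with nowhere vanishing differential. -/
def IsC1Hypersurface {n : ℕ} (M : Set (EuclideanSpace ℝ (Fin n))) : Prop :=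
  ∀ x ∈ M, ∃ U : Set (EuclideanSpace ℝ (Fin n)), IsOpen U ∧ x ∈ U ∧
    ∃ f : EuclideanSpace ℝ (Fin n) → ℝ, ContDiffOn ℝ 1 f U ∧
      (∀ y ∈ U, fderiv ℝ f y ≠ 0) ∧ M ∩ U = {y ∈ U | f y = 0}

/-- The medial axis of `M`: the closure of the set of points of the ambient space that have at
least two nearest points on `M`. -/
def medialAxis {n : ℕ} (M : Set (EuclideanSpace ℝ (Fin n))) : Set (EuclideanSpace ℝ (Fin n)) :=
  closure {x | ∃ y ∈ M, ∃ z ∈ M, y ≠ z ∧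
    (∀ m ∈ M, dist x y ≤ dist x m) ∧ (∀ m ∈ M, dist x z ≤ dist x m)}

/-- The reach of `M`: the infimum over the points of `M` of the distance to the medial axis
(`⊤` if `M` or the medial axis is empty). -/
def reach {n : ℕ} (M : Set (EuclideanSpace ℝ (Fin n))) : ℝ≥0∞ :=
  ⨅ x ∈ M, Metric.infEDist x (medialAxis M)

/-- `L` is an `ε`-sample of `M`: a subset of `M` such that every point of `M` is at distance at
most `ε` from `L`. -/
def IsSample {n : ℕ} (L M : Set (EuclideanSpace ℝ (Fin n))) (ε : ℝ) : Prop :=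
  L ⊆ M ∧ ∀ x ∈ M, Metric.infEDist x L ≤ ENNReal.ofReal ε

/-- `L` is `ε`-sparse: distinct points of `L` are at distance at least `ε`. -/
def IsSparse {n : ℕ} (L : Set (EuclideanSpace ℝ (Fin n))) (ε : ℝ) : Prop :=
  L.Pairwise fun p q => ε ≤ dist p q

/-- The closed Voronoi cell of the site `p` in the Voronoi diagram of `L`. -/
def voronoiCell {n : ℕ} (L : Set (EuclideanSpace ℝ (Fin n))) (p : EuclideanSpace ℝ (Fin n)) :
    Set (EuclideanSpace ℝ (Fin n)) :=
  {x | ∀ q ∈ L, dist x p ≤ dist x q}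

/-- The Delaunay triangulation of `L` restricted to `M`: the nerve of the restriction to `M` of
the Voronoi diagram of `L`. -/
def restrictedDelaunay {n : ℕ} (M L : Set (EuclideanSpace ℝ (Fin n))) :
    PreAbstractSimplicialComplex (EuclideanSpace ℝ (Fin n)) where
  faces := {σ | σ.Nonempty ∧ (σ : Set (EuclideanSpace ℝ (Fin n))) ⊆ L ∧
    (⋂ p ∈ σ, voronoiCell L p ∩ M).Nonempty}
  isRelLowerSet_faces := by
    rintro σ ⟨hσ, hσL, x, hx⟩
    refine ⟨hσ, fun τ hτσ hτ => ⟨hτ, fun p hp => hσL (hτσ hp), x, ?_⟩⟩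
    simp only [mem_iInter] at hx ⊢
    exact fun p hp => hx p (hτσ hp)

/-- `w` witnesses the simplex with vertex set `σ ⊆ L`: each vertex of `σ` is at least as close
to `w` as each point of `L` outside `σ`. -/
def IsWitness {n : ℕ} (L : Set (EuclideanSpace ℝ (Fin n))) (w : EuclideanSpace ℝ (Fin n))
    (σ : Finset (EuclideanSpace ℝ (Fin n))) : Prop :=
  ∀ p ∈ σ, ∀ q ∈ L, q ∉ σ → dist w p ≤ dist w q

/-- The witness complex of `L` relative to `W`: the largest abstract simplicial complex with
vertices in `L` all of whose faces are witnessed by points of `W`. Its simplices are the nonempty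
finite subsets of `L` all of whose nonempty subsets are witnessed
(see `witnessComplex_isGreatest`). -/
def witnessComplex {n : ℕ} (W L : Set (EuclideanSpace ℝ (Fin n))) :
    PreAbstractSimplicialComplex (EuclideanSpace ℝ (Fin n)) where
  faces := {σ | σ.Nonempty ∧ (σ : Set (EuclideanSpace ℝ (Fin n))) ⊆ L ∧
    ∀ τ ⊆ σ, τ.Nonempty → ∃ w ∈ W, IsWitness L w τ}
  isRelLowerSet_faces := by
    rintro σ ⟨hσ, hσL, h⟩
    exact ⟨hσ, fun τ hτσ hτ =>
      ⟨hτ, fun p hp => hσL (hτσ hp), fun ρ hρ => h ρ (hρ.trans hτσ)⟩⟩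

theorem witnessComplex_isGreatest {n : ℕ} (W L : Set (EuclideanSpace ℝ (Fin n))) :
    IsGreatest {K : PreAbstractSimplicialComplex (EuclideanSpace ℝ (Fin n)) |
      ∀ σ ∈ K.faces, (σ : Set (EuclideanSpace ℝ (Fin n))) ⊆ L ∧ ∃ w ∈ W, IsWitness L w σ}
      (witnessComplex W L) := by
  refine ⟨fun σ hσ => ⟨hσ.2.1, hσ.2.2 σ (Finset.Subset.refl σ) hσ.1⟩, fun K hK σ hσ => ?_⟩
  refine ⟨(K.isRelLowerSet_faces hσ).1, (hK σ hσ).1, fun τ hτσ hτ => ?_⟩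
  exact (hK τ ((K.isRelLowerSet_faces hσ).2 hτσ hτ)).2

end

/-! Rescale so that `ε = 1` and the reach is `R = 1 / μ`; `M` is the boundary of the
`R`-neighbourhood of a segment, so near the apex it is a round cylinder, flat in the direction `X
0`.

The sliver is a near-square whose height `X 2` alternates between `e` and `-e`. For `e = 0` its
vertices would be equidistant from a whole plane `X 0 = X 1 = 0`; the twist reduces this plane to
the `X 3`-axis, which meets `M` only at the apex and its antipode, while it changes the distances
from points at height `±z` only by terms of order `e * z`. At the apex the squared distance to the
vertices is `2`, but `2 - e` to the fifth site `topPt R x`, so the apex lies in none of their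
Voronoi cells; the antipode is close to a site of the net `N`. Hence the sliver is not in the
restricted Delaunay triangulation (`sliver_notMem_restrictedDelaunay`).

A witness lies `2 * e * R` below the apex. The vertices lie `64 * e * R` below it and `topPt R x`,
displaced in the flat direction, not at all, so the cross term `2 * (64 * e * R) * (2 * e * R) = 2 *
e` reverses the comparison with `topPt R x`. The direction in which the witness is displaced selects
the face (`sliver_mem_witnessComplex`).

The witnesses are finitely many and do not depend on `η`, so they can be added to any finite net of
`M`; for infinite `W`, take `M` itself. -/

noncomputable section

/-! ### The capsule as a compact `C¹` hypersurface. -/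

/-- The square of the distance of `x` to `(-∞, 2]`. -/
def sqExcess (x : ℝ) : ℝ := (max (x - 2) 0) ^ 2

theorem hasDerivAt_sq_max_zero (x : ℝ) :
    HasDerivAt (fun x : ℝ => (max x 0) ^ 2) (2 * max x 0) x := by
  rcases lt_trichotomy x 0 with h | h | h
  · rw [max_eq_right h.le, mul_zero]
    refine (hasDerivAt_const x (0 : ℝ)).congr_of_eventuallyEq ?_
    filter_upwards [gt_mem_nhds h] with y hy
    simp [max_eq_right hy.le]
  · subst h
    rw [hasDerivAt_iff_isLittleO_nhds_zero]
    have h2 : (fun h : ℝ => h ^ 2) =o[nhds 0] fun h : ℝ => h := by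
      simpa using Asymptotics.isLittleO_pow_pow (𝕜 := ℝ) (m := 1) (n := 2) (by norm_num)
    refine Asymptotics.IsBigO.trans_isLittleO (Asymptotics.IsBigO.of_bound 1 ?_) h2
    refine Filter.Eventually.of_forall fun y => ?_
    rcases le_total y 0 with hy | hy
    · simp [max_eq_right hy]; positivity
    · simp [max_eq_left hy]
  · have h1 : HasDerivAt (fun y : ℝ => y ^ 2) (2 * x) x := by
      simpa using hasDerivAt_pow 2 x
    rw [max_eq_left h.le]
    refine h1.congr_of_eventuallyEq ?_
    filter_upwards [lt_mem_nhds h] with y hy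
    simp [max_eq_left hy.le]

theorem hasDerivAt_sqExcess (x : ℝ) : HasDerivAt sqExcess (2 * max (x - 2) 0) x := by
  exact (hasDerivAt_sq_max_zero (x - 2)).comp_sub_const x 2

theorem contDiff_sqExcess : ContDiff ℝ 1 sqExcess := by
  rw [contDiff_one_iff_deriv]
  refine ⟨fun x => (hasDerivAt_sqExcess x).differentiableAt, ?_⟩
  rw [show deriv sqExcess = fun x => 2 * max (x - 2) 0 from
    funext fun x => (hasDerivAt_sqExcess x).deriv]
  fun_prop

/-- The square of the distance to the segment `[-2, 2] × {0}`. -/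
def segSqDist (X : EuclideanSpace ℝ (Fin 4)) : ℝ :=
  sqExcess (X 0) + sqExcess (-X 0) + X 1 ^ 2 + X 2 ^ 2 + X 3 ^ 2

/-- The capsule of radius `R`: the points at distance `R` from the segment `[-2, 2] × {0}`. -/
def capsule (R : ℝ) : Set (EuclideanSpace ℝ (Fin 4)) := {X | segSqDist X = R ^ 2}

theorem contDiff_segSqDist : ContDiff ℝ 1 segSqDist := by
  unfold segSqDist
  have h (i : Fin 4) : ContDiff ℝ 1 fun X : EuclideanSpace ℝ (Fin 4) => X i := by fun_prop
  exact ((((contDiff_sqExcess.comp (h 0)).add (contDiff_sqExcess.comp (h 0).neg)).add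
    ((h 1).pow 2)).add ((h 2).pow 2)).add ((h 3).pow 2)

/-- The vector `v` below is the displacement of `X` from its nearest point on the segment; the
derivative along it is `2 * segSqDist X`. -/
theorem fderiv_segSqDist_ne_zero {X : EuclideanSpace ℝ (Fin 4)} (hX : 0 < segSqDist X) :
    fderiv ℝ segSqDist X ≠ 0 := by
  intro h0
  set v : EuclideanSpace ℝ (Fin 4) :=
    !₂[max (X 0 - 2) 0 - max (-X 0 - 2) 0, X 1, X 2, X 3] with hv
  have h1 : HasDerivAt (fun s : ℝ => segSqDist (X + s • v)) (fderiv ℝ segSqDist X v) 0 := by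
    have hd : HasFDerivAt segSqDist (fderiv ℝ segSqDist X) (X + (0 : ℝ) • v) := by
      simpa using (contDiff_segSqDist.differentiable one_ne_zero X).hasFDerivAt
    have hl : HasDerivAt (fun s : ℝ => X + s • v) v 0 := by
      simpa using ((hasDerivAt_id (0 : ℝ)).smul_const v).const_add X
    exact hd.comp_hasDerivAt (0 : ℝ) hl
  have hc (i : Fin 4) : HasDerivAt (fun s : ℝ => X i + s * v i) (v i) 0 := by
    simpa using ((hasDerivAt_id (0 : ℝ)).mul_const (v i)).const_add (X i)
  have hp : HasDerivAt (fun s : ℝ => sqExcess (X 0 + s * v 0)) (2 * max (X 0 - 2) 0 * v 0) 0 := by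
    exact HasDerivAt.comp_of_eq (0 : ℝ) (hasDerivAt_sqExcess (X 0)) (hc 0) (by simp)
  have hm : HasDerivAt (fun s : ℝ => sqExcess (-(X 0 + s * v 0)))
      (2 * max (-X 0 - 2) 0 * -v 0) 0 := by
    exact HasDerivAt.comp_of_eq (0 : ℝ) (hasDerivAt_sqExcess (-X 0)) (hc 0).neg (by simp)
  have h2 := (((hp.add hm).add ((hc 1).pow 2)).add ((hc 2).pow 2)).add ((hc 3).pow 2)
  have h3 := h1.unique h2
  have hpm : max (X 0 - 2) 0 * max (-X 0 - 2) 0 = 0 := by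
    rcases le_total (X 0) 2 with h | h
    · rw [max_eq_right (by linarith), zero_mul]
    · rw [max_eq_right (by linarith : -X 0 - 2 ≤ 0), mul_zero]
  have hs : segSqDist X = max (X 0 - 2) 0 ^ 2 + max (-X 0 - 2) 0 ^ 2 + X 1 ^ 2 + X 2 ^ 2 + X 3 ^ 2 :=
    rfl
  rw [h0] at h3
  simp [hv] at h3
  nlinarith [h3, hpm, hs, hX]

theorem isC1Hypersurface_capsule {R : ℝ} (hR : 0 < R) : IsC1Hypersurface (capsule R) := by
  intro X hX
  refine ⟨{Y | 0 < segSqDist Y}, isOpen_lt continuous_const contDiff_segSqDist.continuous, ?_,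
    fun Y => segSqDist Y - R ^ 2, (contDiff_segSqDist.sub contDiff_const).contDiffOn, ?_, ?_⟩
  · change 0 < segSqDist X
    rw [show segSqDist X = R ^ 2 from hX]
    positivity
  · intro Y hY
    rw [fderiv_sub_const]
    exact fderiv_segSqDist_ne_zero hY
  · ext Y
    simp only [capsule, mem_inter_iff, mem_ofPred_eq, sub_eq_zero]
    exact and_comm

theorem isCompact_capsule (R : ℝ) : IsCompact (capsule R) := by
  refine Metric.isCompact_of_isClosed_isBounded
    (isClosed_eq contDiff_segSqDist.continuous continuous_const) ?_
  refine (Metric.isBounded_iff_subset_closedBall 0).2 ⟨|R| + 2 + |R|, fun X hX => ?_⟩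
  rw [mem_closedBall_zero_iff, EuclideanSpace.norm_eq]
  refine Real.sqrt_le_iff.2 ⟨by positivity, ?_⟩
  have hX : max (X 0 - 2) 0 ^ 2 + max (-X 0 - 2) 0 ^ 2 + X 1 ^ 2 + X 2 ^ 2 + X 3 ^ 2 = R ^ 2 := hX
  simp only [Real.norm_eq_abs, sq_abs, Fin.sum_univ_four]
  have hA := abs_nonneg R
  have hRR := sq_abs R
  have h1 : max (X 0 - 2) 0 ≤ |R| := abs_le_of_sq_le_sq' (by nlinarith [sq_nonneg (X 1), sq_nonneg (X 2), sq_nonneg (X 3), sq_nonneg (max (-X 0 - 2) 0)]) hA |>.2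
  have h2 : max (-X 0 - 2) 0 ≤ |R| := abs_le_of_sq_le_sq' (by nlinarith [sq_nonneg (X 1), sq_nonneg (X 2), sq_nonneg (X 3), sq_nonneg (max (X 0 - 2) 0)]) hA |>.2
  have h3 : X 0 ^ 2 ≤ (|R| + 2) ^ 2 :=
    sq_le_sq' (by linarith [le_max_left (-X 0 - 2) 0]) (by linarith [le_max_left (X 0 - 2) 0])
  nlinarith [sq_nonneg (max (X 0 - 2) 0), sq_nonneg (max (-X 0 - 2) 0)]

/-! ### Nearest points, medial axis and reach of the capsule. -/

/-- The point of the segment `[-2, 2] × {0}` nearest to `X`. -/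
def segProj (X : EuclideanSpace ℝ (Fin 4)) : EuclideanSpace ℝ (Fin 4) :=
  !₂[max (-2) (min (X 0) 2), 0, 0, 0]

theorem dist_sq_fin_four (X Y : EuclideanSpace ℝ (Fin 4)) :
    dist X Y ^ 2 = (X 0 - Y 0) ^ 2 + (X 1 - Y 1) ^ 2 + (X 2 - Y 2) ^ 2 + (X 3 - Y 3) ^ 2 := by
  rw [EuclideanSpace.dist_eq, Real.sq_sqrt (by positivity)]
  simp [Fin.sum_univ_four, Real.dist_eq]

theorem dist_segProj_sq (X : EuclideanSpace ℝ (Fin 4)) : dist X (segProj X) ^ 2 = segSqDist X := by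
  rw [dist_sq_fin_four]
  simp only [segProj, segSqDist, sqExcess]
  simp
  rcases le_total (X 0) 2 with h | h
  · rcases le_total (-2) (X 0) with h' | h'
    · rw [min_eq_left h, max_eq_right h', max_eq_right (by linarith), max_eq_right (by linarith)]
      ring
    · rw [min_eq_left h, max_eq_left h', max_eq_right (by linarith), max_eq_left (by linarith)]
      ring
  · rw [min_eq_right h, max_eq_right (by norm_num), max_eq_left (by linarith),
      max_eq_right (by linarith)]
    ring

/-- The surplus square, coming from the obtuse angle at the projection, gives uniqueness of the
nearest point of the segment. -/
theorem segSqDist_le_dist_sq (X : EuclideanSpace ℝ (Fin 4)) {u : ℝ} (hu : |u| ≤ 2) :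
    segSqDist X + (u - max (-2) (min (X 0) 2)) ^ 2 ≤ dist X !₂[u, 0, 0, 0] ^ 2 := by
  rw [← dist_segProj_sq, dist_sq_fin_four, dist_sq_fin_four]
  obtain ⟨h1, h2⟩ := abs_le.1 hu
  simp [segProj]
  rcases le_total (X 0) 2 with h | h
  · rcases le_total (-2) (X 0) with h' | h'
    · rw [min_eq_left h, max_eq_right h']
      nlinarith
    · rw [min_eq_left h, max_eq_left h']
      nlinarith
  · rw [min_eq_right h, max_eq_right (by norm_num)]
    nlinarith

theorem segProj_coord (X : EuclideanSpace ℝ (Fin 4)) : |max (-2) (min (X 0) 2)| ≤ 2 :=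
  abs_le.2 ⟨le_max_left _ _, max_le (by norm_num) (min_le_right _ _)⟩

theorem dist_segProj_of_mem_capsule {R : ℝ} (hR : 0 ≤ R) {X : EuclideanSpace ℝ (Fin 4)}
    (hX : X ∈ capsule R) : dist X (segProj X) = R := by
  rw [← sq_eq_sq₀ dist_nonneg hR, dist_segProj_sq]
  exact hX

theorem dist_segProj_le (X Y : EuclideanSpace ℝ (Fin 4)) :
    dist X (segProj X) ≤ dist X (segProj Y) := by
  refine le_of_sq_le_sq ?_ dist_nonneg
  rw [dist_segProj_sq]
  have := segSqDist_le_dist_sq X (segProj_coord Y)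
  exact le_trans (le_add_of_nonneg_right (sq_nonneg _)) this

theorem segProj_eq_of_dist_le {X Y : EuclideanSpace ℝ (Fin 4)}
    (h : dist X (segProj Y) ≤ dist X (segProj X)) : segProj Y = segProj X := by
  have h1 := segSqDist_le_dist_sq X (segProj_coord Y)
  have h2 : dist X (segProj Y) ^ 2 ≤ segSqDist X := by
    rw [← dist_segProj_sq]
    gcongr
  have h3 : max (-2) (min (Y 0) 2) = max (-2) (min (X 0) 2) := by
    have : (max (-2) (min (Y 0) 2) - max (-2) (min (X 0) 2)) ^ 2 ≤ 0 := by
      unfold segProj at h2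
      linarith
    exact sub_eq_zero.1 (pow_eq_zero_iff two_ne_zero |>.1 (le_antisymm this (sq_nonneg _)))
  rw [segProj, segProj, h3]

/-- Nearest points on the capsule of a point off its axis lie on the ray from the axis. -/
theorem eq_of_dist_le_capsule {R : ℝ} (hR : 0 < R) {X m : EuclideanSpace ℝ (Fin 4)}
    (hX : X ≠ segProj X) (hm : m ∈ capsule R)
    (hle : dist X m ≤ |dist X (segProj X) - R|) :
    m = segProj X + (R / dist X (segProj X)) • (X - segProj X) := by
  have hd : 0 < dist X (segProj X) := dist_pos.2 hX
  have hmR := dist_segProj_of_mem_capsule hR.le hm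
  have hc : segProj m = segProj X := by
    -- Both for `X` outside and inside the capsule, the triangle inequality makes the projection of
    -- one of `X`, `m` a nearest point of the segment to the other.
    rcases le_total R (dist X (segProj X)) with h | h
    · rw [abs_of_nonneg (by linarith)] at hle
      apply segProj_eq_of_dist_le
      linarith [dist_triangle X m (segProj m)]
    · rw [abs_of_nonpos (by linarith)] at hle
      refine (segProj_eq_of_dist_le ?_).symm
      linarith [dist_triangle m X (segProj X), dist_comm m X]
  rw [hc] at hmR
  set c := segProj X
  set d := dist X c
  have hn1 : ‖X - c‖ = d := (dist_eq_norm X c).symm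
  have hn2 : ‖m - c‖ = R := by rw [← dist_eq_norm, hmR]
  have hsq : ‖X - m‖ ^ 2 ≤ (d - R) ^ 2 := by
    rw [← dist_eq_norm, ← sq_abs (d - R)]
    gcongr
  have hexp : ‖X - m‖ ^ 2 = d ^ 2 - 2 * inner ℝ (X - c) (m - c) + R ^ 2 := by
    rw [← hn1, ← hn2, ← norm_sub_sq_real, sub_sub_sub_cancel_right]
  -- Equality in Cauchy–Schwarz makes `m - c` a positive multiple of `X - c`.
  have hin : inner ℝ (X - c) (m - c) = ‖X - c‖ * ‖m - c‖ := by
    refine le_antisymm (real_inner_le_norm _ _) ?_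
    rw [hn1, hn2]
    nlinarith
  have := inner_eq_norm_mul_iff_real.1 hin
  rw [hn1, hn2] at this
  rw [← sub_eq_iff_eq_add'] 
  rw [div_eq_inv_mul, mul_smul, this, smul_smul, inv_mul_cancel₀ hd.ne', one_smul]

/-- This is the coordinate form of the fact that the ray from the projection of `X` through `X`
projects to a single point. -/
theorem max_min_ray (x : ℝ) {s : ℝ} (hs : 0 ≤ s) :
    max (-2) (min (max (-2) (min x 2) + s * (x - max (-2) (min x 2))) 2) =
      max (-2) (min x 2) := by
  rcases le_total x 2 with h | h
  · rcases le_total (-2) x with h' | h'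
    · simp [min_eq_left h, max_eq_right h']
    · rw [min_eq_left h, max_eq_left h', min_eq_left (by nlinarith), max_eq_left (by nlinarith)]
  · rw [min_eq_right h, max_eq_right (by norm_num : (-2 : ℝ) ≤ 2), min_eq_right (by nlinarith),
      max_eq_right (by norm_num)]

theorem mem_capsule_ray {R : ℝ} {X : EuclideanSpace ℝ (Fin 4)} (hR : 0 < R)
    (hX : X ≠ segProj X) :
    segProj X + (R / dist X (segProj X)) • (X - segProj X) ∈ capsule R := by
  have hd : 0 < dist X (segProj X) := dist_pos.2 hX
  have hs : 0 ≤ R / dist X (segProj X) := by positivity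
  set s := R / dist X (segProj X)
  have hc : segProj (segProj X + s • (X - segProj X)) = segProj X := by
    have := max_min_ray (X 0) hs
    simp only [segProj] 
    simp [this]
  change segSqDist _ = R ^ 2
  rw [← dist_segProj_sq, hc, dist_eq_norm, add_sub_cancel_left, norm_smul, ← dist_eq_norm,
    Real.norm_of_nonneg hs, div_mul_cancel₀ _ hd.ne']

theorem medialAxis_capsule_subset {R : ℝ} (hR : 0 < R) {X m m' : EuclideanSpace ℝ (Fin 4)}
    (hm : m ∈ capsule R) (hm' : m' ∈ capsule R) (hne : m ≠ m')
    (h : ∀ y ∈ capsule R, dist X m ≤ dist X y) (h' : ∀ y ∈ capsule R, dist X m' ≤ dist X y) :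
    X = segProj X := by
  by_contra hX
  have hd : 0 < dist X (segProj X) := dist_pos.2 hX
  have hle : dist X (segProj X + (R / dist X (segProj X)) • (X - segProj X)) ≤
      |dist X (segProj X) - R| := by
    have hsub : X - (segProj X + (R / dist X (segProj X)) • (X - segProj X)) =
      (1 - R / dist X (segProj X)) • (X - segProj X) := by module
    rw [dist_eq_norm, hsub, norm_smul, ← dist_eq_norm X, Real.norm_eq_abs]
    nth_rewrite 2 [← abs_of_pos hd]
    rw [← abs_mul, sub_mul, one_mul, div_mul_cancel₀ _ hd.ne']
  have hray := mem_capsule_ray hR hX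
  exact hne ((eq_of_dist_le_capsule hR hX hm ((h _ hray).trans hle)).trans
    (eq_of_dist_le_capsule hR hX hm' ((h' _ hray).trans hle)).symm)

theorem mem_capsule_of_abs_le {R x y z t : ℝ} (hx : |x| ≤ 2) (h : y ^ 2 + z ^ 2 + t ^ 2 = R ^ 2) :
    !₂[x, y, z, t] ∈ capsule R := by
  obtain ⟨h1, h2⟩ := abs_le.1 hx
  change segSqDist _ = _
  simp [segSqDist, sqExcess, max_eq_right (by linarith : x - 2 ≤ 0),
    max_eq_right (by linarith : -x - 2 ≤ 0), h]

/-- Ties occur only on the segment, all of whose points are at distance at least `R` from the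
capsule; the origin is tied between `(0, 0, 0, ±R)`, at distance exactly `R`. -/
theorem reach_capsule {R : ℝ} (hR : 0 < R) : reach (capsule R) = ENNReal.ofReal R := by
  simp only [reach, medialAxis, Metric.infEDist_closure]
  apply le_antisymm
  · have hO : !₂[0, 0, 0, R] ∈ capsule R := mem_capsule_of_abs_le (by norm_num) (by ring)
    have hO' : !₂[0, 0, 0, -R] ∈ capsule R := mem_capsule_of_abs_le (by norm_num) (by ring)
    have hdist (s : ℝ) (hs : s ^ 2 = R ^ 2) :
        dist (0 : EuclideanSpace ℝ (Fin 4)) !₂[0, 0, 0, s] = R := by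
      rw [← sq_eq_sq₀ dist_nonneg hR.le, dist_sq_fin_four]
      simp [hs]
    have hmin : ∀ m ∈ capsule R, R ≤ dist 0 m := by
      intro m hm
      rw [← dist_segProj_of_mem_capsule hR.le hm, dist_comm]
      have h0 : segProj 0 = 0 := by
        ext i
        fin_cases i <;> simp [segProj]
      rw [← h0, dist_comm, h0]
      simpa [h0] using dist_segProj_le m 0
    refine (iInf₂_le _ hO).trans ((Metric.infEDist_le_edist_of_mem
      (y := (0 : EuclideanSpace ℝ (Fin 4))) ?_).trans ?_)
    · refine ⟨_, hO, _, hO', fun h => ?_, fun m hm => ?_, fun m hm => ?_⟩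
      · have := congrArg (fun v : EuclideanSpace ℝ (Fin 4) => v 3) h
        simp at this
        linarith
      · rw [hdist R rfl]
        exact hmin m hm
      · rw [hdist (-R) (by ring)]
        exact hmin m hm
    · rw [edist_comm, edist_dist, hdist R rfl]
  · refine le_iInf₂ fun m hm => Metric.le_infEDist.2 ?_
    rintro X ⟨y, hy, z, hz, hne, h1, h2⟩
    rw [edist_dist, ← dist_segProj_of_mem_capsule hR.le hm,
      medialAxis_capsule_subset hR hy hz hne h1 h2]
    exact ENNReal.ofReal_le_ofReal (dist_segProj_le m X)

/-! ### Nets and samples. -/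

/-- A maximal separated set is a net at the same scale; its finiteness comes from comparing packing
at scale `r` with covering at scale `r / 2`. -/
theorem exists_finite_separated_net {X : Type*} [MetricSpace X] {S : Set X}
    (hS : TotallyBounded S) {r : ℝ} (hr : 0 < r) :
    ∃ N ⊆ S, N.Finite ∧ (N.Pairwise fun p q => r ≤ dist p q) ∧ ∀ x ∈ S, ∃ q ∈ N, dist x q ≤ r := by
  lift r to NNReal using hr.le
  have hr' : 0 < r := by exact_mod_cast hr
  have htop : Metric.packingNumber r S ≠ ⊤ := by
    obtain ⟨F, hFS, hF, hcov⟩ := Metric.exists_finite_isCover_of_totallyBounded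
      (ε := r / 2) (by positivity) hS
    have h1 := Metric.packingNumber_two_mul_le_externalCoveringNumber (r / 2) S
    rw [mul_div_cancel₀ _ two_ne_zero] at h1
    refine ne_top_of_le_ne_top ?_ (h1.trans (hcov.externalCoveringNumber_le_encard))
    exact hF.encard_lt_top.ne
  refine ⟨Metric.maximalSeparatedSet r S, Metric.maximalSeparatedSet_subset, ?_, ?_, ?_⟩
  · rw [← Set.encard_ne_top_iff, Metric.encard_maximalSeparatedSet htop]
    exact htop
  · intro p hp q hq hpq
    have : (r : ENNReal) < edist p q := Metric.isSeparated_maximalSeparatedSet hp hq hpq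
    rw [edist_nndist, ENNReal.coe_lt_coe] at this
    exact_mod_cast this.le
  · intro x hx
    obtain ⟨q, hq, hxq⟩ := Metric.isCover_maximalSeparatedSet htop hx
    refine ⟨q, hq, ?_⟩
    have h : edist x q ≤ r := hxq
    rw [edist_nndist, ENNReal.coe_le_coe] at h
    exact_mod_cast h

theorem isSample_of_forall_exists_dist_le {n : ℕ} {L M : Set (EuclideanSpace ℝ (Fin n))} {r : ℝ}
    (hLM : L ⊆ M) (h : ∀ x ∈ M, ∃ q ∈ L, dist x q ≤ r) : IsSample L M r := by
  refine ⟨hLM, fun x hx => ?_⟩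
  obtain ⟨q, hq, hxq⟩ := h x hx
  exact (Metric.infEDist_le_edist_of_mem hq).trans
    (by rw [edist_dist]; exact ENNReal.ofReal_le_ofReal hxq)

theorem isSample_self {n : ℕ} (M : Set (EuclideanSpace ℝ (Fin n))) {r : ℝ} (hr : 0 ≤ r) :
    IsSample M M r :=
  isSample_of_forall_exists_dist_le subset_rfl fun x hx => ⟨x, hx, by rwa [dist_self]⟩

theorem IsSample.mono {n : ℕ} {L M : Set (EuclideanSpace ℝ (Fin n))} {r s : ℝ}
    (h : IsSample L M r) (hrs : r ≤ s) : IsSample L M s :=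
  ⟨h.1, fun x hx => (h.2 x hx).trans (ENNReal.ofReal_le_ofReal hrs)⟩

/-- A simplex of the witness complex relative to a compact set `M` belongs to the witness complex
relative to some arbitrarily dense finite subset of `M`. -/
theorem exists_finite_isSample_mem_witnessComplex {n : ℕ} {M L : Set (EuclideanSpace ℝ (Fin n))}
    (hM : IsCompact M) {σ : Finset (EuclideanSpace ℝ (Fin n))}
    (hσ : σ ∈ (witnessComplex M L).faces) {r : ℝ} (hr : 0 < r) :
    ∃ W : Set (EuclideanSpace ℝ (Fin n)), W.Finite ∧ IsSample W M r ∧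
      σ ∈ (witnessComplex W L).faces := by
  classical
  obtain ⟨hne, hL, hw⟩ := hσ
  obtain ⟨F, hFM, hF, hcov⟩ := hM.finite_cover_balls hr
  have hw' : ∀ τ : {τ // τ ⊆ σ ∧ τ.Nonempty}, ∃ w ∈ M, IsWitness L w τ :=
    fun τ => hw τ.1 τ.2.1 τ.2.2
  choose g hgM hg using hw'
  have hfin : Finite {τ // τ ⊆ σ ∧ τ.Nonempty} :=
    Set.Finite.to_subtype ((Finset.finite_toSet σ.powerset).subset fun τ hτ => by
      simpa using hτ.1)
  refine ⟨F ∪ range g, hF.union (finite_range g), ?_, hne, hL, fun τ hτ hτ' =>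
    ⟨g ⟨τ, hτ, hτ'⟩, Or.inr (mem_range_self _), hg ⟨τ, hτ, hτ'⟩⟩⟩
  refine isSample_of_forall_exists_dist_le (union_subset hFM ?_) fun x hx => ?_
  · rintro _ ⟨τ, rfl⟩
    exact hgM τ
  · obtain ⟨q, hq, hxq⟩ := mem_iUnion₂.1 (hcov hx)
    exact ⟨q, Or.inl hq, (Metric.mem_ball.1 hxq).le⟩

theorem infinite_capsule (R : ℝ) : (capsule R).Infinite := by
  refine Set.infinite_of_injOn_mapsTo (f := fun x : ℝ => !₂[x, 0, 0, R]) (fun x _ y _ h => ?_)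
    (fun x hx => mem_capsule_of_abs_le (abs_le.2 ⟨by linarith [hx.1], hx.2⟩) (by ring))
    (Set.Icc_infinite (show (0 : ℝ) < 2 by norm_num))
  simpa using congrArg (fun v : EuclideanSpace ℝ (Fin 4) => v 0) h

/-! ### The near-square and its distances. -/

/-- The parameters of a near-square on the capsule of radius `R`: its vertices are
`(±1, ±y, ±e, R - 64 e R)`, and `(x, 0, 0, R)` is a fifth nearly cocircular point. The points
`(0, ±z, 0, R - 2 e R)` and `(0, 0, ±z, R - 2 e R)` of the capsule serve as witnesses. -/
structure IsSliver (R e x y z : ℝ) : Prop where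
  three_lt : 3 < R
  e_eq : 128 * R ^ 2 * e = 1
  x_nonneg : 0 ≤ x
  x_sq : x ^ 2 = 2 - e
  y_nonneg : 0 ≤ y
  y_sq : y ^ 2 = 1 - 32 * e - e ^ 2
  z_nonneg : 0 ≤ z
  z_sq : z ^ 2 = 1 / 32 - e / 32

theorem exists_isSliver {R : ℝ} (hR : 3 < R) : ∃ e x y z, IsSliver R e x y z := by
  have he : 128 * R ^ 2 * (1 / (128 * R ^ 2)) = 1 := by field_simp
  have he0 : 0 < 1 / (128 * R ^ 2) := by positivity
  set e := 1 / (128 * R ^ 2)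
  have he1 : e ≤ 1 / 1152 := by nlinarith
  exact ⟨e, √(2 - e), √(1 - 32 * e - e ^ 2), √(1 / 32 - e / 32), hR, he, Real.sqrt_nonneg _,
    Real.sq_sqrt (by linarith), Real.sqrt_nonneg _, Real.sq_sqrt (by nlinarith),
    Real.sqrt_nonneg _, Real.sq_sqrt (by linarith)⟩

/-- The apex of the capsule. -/
def apex (R : ℝ) : EuclideanSpace ℝ (Fin 4) := !₂[0, 0, 0, R]

/-- The point `(x, y, z, R - 64 e R)`. -/
def sliverPt (R e x y z : ℝ) : EuclideanSpace ℝ (Fin 4) := !₂[x, y, z, R - 64 * e * R]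

/-- The point `(x, y, z, R - 2 e R)`. -/
def witnessPt (R e x y z : ℝ) : EuclideanSpace ℝ (Fin 4) := !₂[x, y, z, R - 2 * e * R]

/-- The point `(x, 0, 0, R)`. -/
def topPt (R x : ℝ) : EuclideanSpace ℝ (Fin 4) := !₂[x, 0, 0, R]

theorem dist_witnessPt_sliverPt (R e x y z x' y' z' : ℝ) :
    dist (witnessPt R e x y z) (sliverPt R e x' y' z') ^ 2 =
      (x - x') ^ 2 + (y - y') ^ 2 + (z - z') ^ 2 + (62 * e * R) ^ 2 := by
  rw [dist_sq_fin_four]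
  simp [witnessPt, sliverPt]
  ring

theorem dist_witnessPt_topPt (R e x y z x' : ℝ) :
    dist (witnessPt R e x y z) (topPt R x') ^ 2 =
      (x - x') ^ 2 + y ^ 2 + z ^ 2 + (2 * e * R) ^ 2 := by
  rw [dist_sq_fin_four]
  simp [witnessPt, topPt]

theorem dist_sliverPt_topPt (R e x y z x' : ℝ) :
    dist (sliverPt R e x y z) (topPt R x') ^ 2 =
      (x - x') ^ 2 + y ^ 2 + z ^ 2 + (64 * e * R) ^ 2 := by
  rw [dist_sq_fin_four]
  simp [sliverPt, topPt]

theorem dist_sliverPt_sliverPt (R e x y z x' y' z' : ℝ) :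
    dist (sliverPt R e x y z) (sliverPt R e x' y' z') ^ 2 =
      (x - x') ^ 2 + (y - y') ^ 2 + (z - z') ^ 2 := by
  rw [dist_sq_fin_four]
  simp [sliverPt]

theorem apex_eq_topPt (R : ℝ) : apex R = topPt R 0 := rfl

namespace IsSliver

variable {R e x y z : ℝ}

theorem e_pos (h : IsSliver R e x y z) : 0 < e := by
  have h1 := h.three_lt
  have h2 := h.e_eq
  by_contra! h3
  nlinarith [mul_nonneg (sq_nonneg R) (neg_nonneg.2 h3)]

theorem e_le (h : IsSliver R e x y z) : e ≤ 1 / 1152 := by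
  have h1 := h.three_lt
  have h2 := h.e_eq
  nlinarith [h.e_pos]

/-- Through this identity every squared vertical offset becomes a multiple of `e`, which makes the
later comparisons linear. -/
theorem eR_sq (h : IsSliver R e x y z) : (e * R) ^ 2 = e / 128 := by
  linear_combination (e / 128) * h.e_eq

theorem x_le (h : IsSliver R e x y z) : x ≤ 3 / 2 := by nlinarith [h.x_sq, h.e_pos]

theorem z_le (h : IsSliver R e x y z) : z ≤ 1 / 5 := by nlinarith [h.z_sq, h.e_pos]

theorem half_le_y_sq (h : IsSliver R e x y z) : 1 / 2 ≤ y ^ 2 := by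
  nlinarith [h.y_sq, h.e_pos, h.e_le]

theorem y_pos (h : IsSliver R e x y z) : 0 < y := by
  refine lt_of_le_of_ne h.y_nonneg fun h0 => ?_
  have := h.half_le_y_sq
  rw [← h0] at this
  norm_num at this

theorem sliverPt_mem (h : IsSliver R e x y z) {a b c : ℝ} (ha : |a| ≤ 2) (hb : b ^ 2 = y ^ 2)
    (hc : c ^ 2 = e ^ 2) : sliverPt R e a b c ∈ capsule R :=
  mem_capsule_of_abs_le ha (by
    rw [hb, hc]
    linear_combination h.y_sq - h.e_eq + 4096 * h.eR_sq)

theorem witnessPt_mem (h : IsSliver R e x y z) {a b c : ℝ} (ha : |a| ≤ 2)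
    (hbc : b ^ 2 + c ^ 2 = z ^ 2) : witnessPt R e a b c ∈ capsule R :=
  mem_capsule_of_abs_le ha (by
    rw [hbc]
    linear_combination h.z_sq - (1 / 32) * h.e_eq + 4 * h.eR_sq)

theorem topPt_mem (h : IsSliver R e x y z) : topPt R x ∈ capsule R :=
  mem_capsule_of_abs_le (abs_le.2 ⟨by linarith [h.x_nonneg], by linarith [h.x_le]⟩) (by ring)

theorem dist_sliverPt_apex_le (h : IsSliver R e x y z) {a b c : ℝ} (ha : a ^ 2 = 1)
    (hb : b ^ 2 = y ^ 2) (hc : c ^ 2 = e ^ 2) : dist (sliverPt R e a b c) (apex R) ≤ 3 / 2 := by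
  refine le_of_sq_le_sq ?_ (by norm_num)
  rw [apex_eq_topPt, dist_sliverPt_topPt]
  nlinarith [h.y_sq, h.eR_sq]

theorem dist_topPt_apex_le (h : IsSliver R e x y z) : dist (topPt R x) (apex R) ≤ 3 / 2 := by
  refine le_of_sq_le_sq ?_ (by norm_num)
  rw [dist_sq_fin_four]
  simp [topPt, apex]
  nlinarith [h.x_sq, h.e_pos]

theorem dist_witnessPt_apex_le (h : IsSliver R e x y z) {a b c : ℝ} (ha : |a| ≤ e * z)
    (hbc : b ^ 2 + c ^ 2 = z ^ 2) : dist (witnessPt R e a b c) (apex R) ≤ 1 / 2 := by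
  refine le_of_sq_le_sq ?_ (by norm_num)
  rw [apex_eq_topPt, dist_witnessPt_topPt]
  have h1 : a ^ 2 ≤ (e * z) ^ 2 := sq_le_sq' (abs_le.1 ha).1 (abs_le.1 ha).2
  have h2 : e * z ≤ 1 * (1 / 5) :=
    mul_le_mul (by linarith [h.e_le]) h.z_le h.z_nonneg (by norm_num)
  have h3 : 0 ≤ e * z := mul_nonneg h.e_pos.le h.z_nonneg
  nlinarith [h.z_sq, h.eR_sq, h.e_pos, h.e_le]

end IsSliver

/-! ### The sites, and the sliver as a witnessed simplex that is not Delaunay. -/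

/-- The four vertices of the sliver. -/
def sliver (R e y : ℝ) : Finset (EuclideanSpace ℝ (Fin 4)) := open Classical in
  {sliverPt R e 1 (-y) e, sliverPt R e (-1) (-y) (-e), sliverPt R e (-1) y e,
    sliverPt R e 1 y (-e)}

theorem mem_sliver {R e y : ℝ} {p : EuclideanSpace ℝ (Fin 4)} :
    p ∈ sliver R e y ↔ p = sliverPt R e 1 (-y) e ∨ p = sliverPt R e (-1) (-y) (-e) ∨
      p = sliverPt R e (-1) y e ∨ p = sliverPt R e 1 y (-e) := by
  simp [sliver]

/-- The sliver, the nearby point on the axis of the cylinder and the points of `N`. -/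
def sliverSites (R e x y : ℝ) (N : Set (EuclideanSpace ℝ (Fin 4))) :
    Set (EuclideanSpace ℝ (Fin 4)) :=
  {topPt R x} ∪ (sliver R e y ∪ N)

namespace IsSliver

variable {R e x y z : ℝ} {N : Set (EuclideanSpace ℝ (Fin 4))}

theorem mem_capsule_and_dist_apex_le (h : IsSliver R e x y z) {p : EuclideanSpace ℝ (Fin 4)}
    (hp : p ∈ sliver R e y) : p ∈ capsule R ∧ dist p (apex R) ≤ 3 / 2 := by
  rcases mem_sliver.1 hp with rfl | rfl | rfl | rfl <;>
  exact ⟨h.sliverPt_mem (by norm_num) (by ring) (by ring),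
    h.dist_sliverPt_apex_le (by ring) (by ring) (by ring)⟩

theorem sliverSites_subset (h : IsSliver R e x y z) (hN : N ⊆ capsule R) :
    sliverSites R e x y N ⊆ capsule R := by
  rintro p (rfl | hp | hp)
  · exact h.topPt_mem
  · exact (h.mem_capsule_and_dist_apex_le hp).1
  · exact hN hp

theorem isSparse_sliverSites (h : IsSliver R e x y z) (hN : ∀ q ∈ N, 3 ≤ dist q (apex R))
    (hs : N.Pairwise fun p q => 1 / 2 ≤ dist p q) :
    IsSparse (sliverSites R e x y N) (1 / 2) := by
  have hsymm : Std.Symm fun p q : EuclideanSpace ℝ (Fin 4) => (1 / 2 : ℝ) ≤ dist p q :=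
    ⟨fun p q hpq => (dist_comm p q).symm ▸ hpq⟩
  have hfar {p q : EuclideanSpace ℝ (Fin 4)} (hp : dist p (apex R) ≤ 3 / 2) (hq : q ∈ N) :
      1 / 2 ≤ dist p q := by
    linarith [hN q hq, dist_triangle q p (apex R), dist_comm p q]
  have hy := h.half_le_y_sq
  have htop {a b c : ℝ} (hb : b ^ 2 = y ^ 2) :
      1 / 2 ≤ dist (topPt R x) (sliverPt R e a b c) := by
    refine le_of_sq_le_sq ?_ dist_nonneg
    rw [dist_comm, dist_sliverPt_topPt]
    nlinarith [sq_nonneg (a - x), sq_nonneg c, sq_nonneg (64 * e * R)]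
  have hss {a b c a' b' c' : ℝ} (hab : 1 / 2 ≤ (a - a') ^ 2 + (b - b') ^ 2) :
      1 / 2 ≤ dist (sliverPt R e a b c) (sliverPt R e a' b' c') := by
    refine le_of_sq_le_sq ?_ dist_nonneg
    rw [dist_sliverPt_sliverPt]
    nlinarith [sq_nonneg (c - c')]
  refine pairwise_union_of_symm.2 ⟨pairwise_singleton _ _,
    pairwise_union_of_symm.2 ⟨?_, hs, fun p hp q hq _ =>
      hfar (h.mem_capsule_and_dist_apex_le hp).2 hq⟩, ?_⟩
  · intro p hp q hq hpq
    rcases mem_sliver.1 hp with rfl | rfl | rfl | rfl <;>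
    rcases mem_sliver.1 hq with rfl | rfl | rfl | rfl <;>
    first
    | exact absurd rfl hpq
    | exact hss (by nlinarith)
  · rintro p rfl q (hq | hq) _
    · rcases mem_sliver.1 hq with rfl | rfl | rfl | rfl <;> exact htop (by ring)
    · exact hfar h.dist_topPt_apex_le hq

theorem exists_dist_sliverSites_le (hN : ∀ p ∈ capsule R, 3 ≤ dist p (apex R) →
      ∃ q ∈ N, dist p q ≤ 1 / 2) (h : IsSliver R e x y z)
    {p : EuclideanSpace ℝ (Fin 4)} (hp : p ∈ capsule R) :
    ∃ q ∈ sliverSites R e x y N, dist p q ≤ 5 := by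
  rcases le_total 3 (dist p (apex R)) with h3 | h3
  · obtain ⟨q, hq, hpq⟩ := hN p hp h3
    exact ⟨q, Or.inr (Or.inr hq), by linarith⟩
  · exact ⟨topPt R x, Or.inl rfl, by
      linarith [dist_triangle_right p (topPt R x) (apex R), h.dist_topPt_apex_le]⟩

theorem sliver_notMem_restrictedDelaunay (h : IsSliver R e x y z)
    (hN : ∀ p ∈ capsule R, 3 ≤ dist p (apex R) → ∃ q ∈ N, dist p q ≤ 1 / 2) :
    sliver R e y ∉ (restrictedDelaunay (capsule R) (sliverSites R e x y N)).faces := by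
  rintro ⟨-, -, X, hX⟩
  simp only [mem_iInter] at hX
  have key {p q : EuclideanSpace ℝ (Fin 4)} (hp : p ∈ sliver R e y) (hq : q ∈ sliver R e y) :
      dist X p ^ 2 = dist X q ^ 2 := by
    rw [le_antisymm ((hX p hp).1 q (Or.inr (Or.inl hq))) ((hX q hq).1 p (Or.inr (Or.inl hp)))]
  have m1 := mem_sliver.2 (Or.inl (Eq.refl (sliverPt R e 1 (-y) e)))
  have m2 := mem_sliver.2 (Or.inr (Or.inl (Eq.refl (sliverPt R e (-1) (-y) (-e)))))
  have m3 := mem_sliver.2 (Or.inr (Or.inr (Or.inl (Eq.refl (sliverPt R e (-1) y e)))))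
  have m4 := mem_sliver.2 (Or.inr (Or.inr (Or.inr (Eq.refl (sliverPt R e 1 y (-e))))))
  have h12 := key m1 m2
  have h13 := key m1 m3
  have h14 := key m1 m4
  simp only [dist_sq_fin_four] at h12 h13 h14
  simp [sliverPt] at h12 h13 h14
  -- Equidistance reads `X 0 = y * X 1 = e * X 2 = -X 0`.
  have hX0 : X 0 = 0 := by linarith
  have hX1 : X 1 = 0 := by
    have : y * X 1 = 0 := by linarith
    exact (mul_eq_zero.1 this).resolve_left h.y_pos.ne'
  have hX2 : X 2 = 0 := by
    have : e * X 2 = 0 := by linarith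
    exact (mul_eq_zero.1 this).resolve_left h.e_pos.ne'
  have hM : segSqDist X = R ^ 2 := (hX _ m1).2
  have hX3 : X 3 ^ 2 = R ^ 2 := by
    rw [← hM]
    simp [segSqDist, sqExcess, hX0, hX1, hX2]
  rcases sq_eq_sq_iff_eq_or_eq_neg.1 hX3 with h3 | h3
  · have hle := pow_le_pow_left₀ dist_nonneg ((hX _ m1).1 (topPt R x) (Or.inl rfl)) 2
    rw [dist_sq_fin_four, dist_sq_fin_four] at hle
    simp [sliverPt, topPt, hX0, hX1, hX2, h3] at hle
    nlinarith [h.x_sq, h.y_sq, h.eR_sq, h.e_pos]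
  -- The antipode is `2 * R > 6` from the apex, so a site of `N` within `1 / 2` beats the sliver.
  · have hR := h.three_lt
    have hfar : 3 ≤ dist X (apex R) := by
      refine le_of_sq_le_sq ?_ dist_nonneg
      rw [dist_sq_fin_four]
      simp [apex, hX0, hX1, hX2, h3]
      nlinarith
    obtain ⟨q, hq, hXq⟩ := hN X (hX _ m1).2 hfar
    linarith [(hX _ m1).1 q (Or.inr (Or.inr hq)), (h.mem_capsule_and_dist_apex_le m1).2,
      dist_triangle X (sliverPt R e 1 (-y) e) (apex R)]

/-- Only the five sites near the apex need comparison: the witness is within `1 / 2 + 3 / 2` of the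
sliver, but at least `3 - 1 / 2` from `N`. -/
theorem isWitness_witnessPt (h : IsSliver R e x y z) (hN : ∀ q ∈ N, 3 ≤ dist q (apex R))
    {τ : Finset (EuclideanSpace ℝ (Fin 4))} (hτ : τ ⊆ sliver R e y) {a b c : ℝ}
    (ha : |a| ≤ e * z) (hbc : b ^ 2 + c ^ 2 = z ^ 2)
    (htop : ∀ p ∈ τ, dist (witnessPt R e a b c) p ^ 2 ≤
      dist (witnessPt R e a b c) (topPt R x) ^ 2)
    (hle : ∀ p ∈ τ, ∀ q ∈ sliver R e y, q ∉ τ → dist (witnessPt R e a b c) p ^ 2 ≤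
      dist (witnessPt R e a b c) q ^ 2) :
    ∃ w ∈ capsule R, IsWitness (sliverSites R e x y N) w τ := by
  have h2 : |a| ≤ 2 := ha.trans (by nlinarith [h.z_le, h.z_nonneg, h.e_le, h.e_pos])
  refine ⟨_, h.witnessPt_mem h2 hbc, ?_⟩
  rintro p hp q (rfl | hq | hq) hqτ
  · exact le_of_sq_le_sq (htop p hp) dist_nonneg
  · exact le_of_sq_le_sq (hle p hp q hq hqτ) dist_nonneg
  · have h3 := h.dist_witnessPt_apex_le ha hbc
    set w := witnessPt R e a b c
    linarith [hN q hq, (h.mem_capsule_and_dist_apex_le (hτ hp)).2, dist_triangle_right w p (apex R),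
      dist_triangle q w (apex R), dist_comm q w]

/-- A face with at least two vertices contains a diagonal or is an edge of the near-square. A
displacement by `±z` in `X 2` favours one diagonal and leaves ties within each diagonal, which
handles every face containing that diagonal; the four edges have their own witnesses. -/
theorem sliver_mem_witnessComplex (h : IsSliver R e x y z)
    (hN : ∀ q ∈ N, 3 ≤ dist q (apex R)) :
    sliver R e y ∈ (witnessComplex (capsule R) (sliverSites R e x y N)).faces := by
  refine ⟨⟨_, mem_sliver.2 (Or.inl rfl)⟩, fun p hp => Or.inr (Or.inl hp), fun τ hτ hne => ?_⟩
  have hsingle {p : EuclideanSpace ℝ (Fin 4)} (hp : p ∈ τ) (h1 : ∀ q ∈ τ, q = p) :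
      ∃ w ∈ capsule R, IsWitness (sliverSites R e x y N) w τ := by
    refine ⟨p, (h.mem_capsule_and_dist_apex_le (hτ hp)).1, fun q hq r _ _ => ?_⟩
    rw [h1 q hq, dist_self]
    exact dist_nonneg
  have hmem : ∀ p ∈ τ, p = sliverPt R e 1 (-y) e ∨ p = sliverPt R e (-1) (-y) (-e) ∨
      p = sliverPt R e (-1) y e ∨ p = sliverPt R e 1 y (-e) := fun p hp => mem_sliver.1 (hτ hp)
  have hez : 0 ≤ e * z := mul_nonneg h.e_pos.le h.z_nonneg
  have hyz : 0 ≤ y * z := mul_nonneg h.y_nonneg h.z_nonneg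
  -- The margin over `topPt R x` is `e`; a shift by `e * z` towards that site costs `2 * e * z * x`.
  have hezx : e * z * x ≤ e / 2 := by
    have : z * x ≤ (1 / 5) * (3 / 2) := mul_le_mul h.z_le h.x_le h.x_nonneg (by norm_num)
    nlinarith [h.e_pos]
  have hezx' : 0 ≤ e * z * x := mul_nonneg hez h.x_nonneg
  have hez' : e * z ≤ e / 2 := by nlinarith [h.z_le, h.e_pos]
  have hx := h.x_sq
  have hy := h.y_sq
  have heR := h.eR_sq
  have he := h.e_pos
  have e0 : |(0 : ℝ)| ≤ e * z := by simpa using hez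
  have e1 : |e * z| ≤ e * z := (abs_of_nonneg hez).le
  have e2 : |-(e * z)| ≤ e * z := by rw [abs_neg, abs_of_nonneg hez]
  have w13 (h1 : sliverPt R e 1 (-y) e ∈ τ) (h3 : sliverPt R e (-1) y e ∈ τ) :
      ∃ w ∈ capsule R, IsWitness (sliverSites R e x y N) w τ := by
    refine h.isWitness_witnessPt hN hτ (a := 0) (b := 0) (c := z) e0 (by ring)
      (fun p hp => ?_) fun p hp q hq hqτ => ?_
    all_goals
      rcases hmem p hp with rfl | rfl | rfl | rfl <;> first
      | contradiction
      | simp only [dist_witnessPt_sliverPt, dist_witnessPt_topPt]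
        linarith
      | rcases mem_sliver.1 hq with rfl | rfl | rfl | rfl <;> first
        | contradiction
        | simp only [dist_witnessPt_sliverPt]
          linarith
  have w24 (h2 : sliverPt R e (-1) (-y) (-e) ∈ τ) (h4 : sliverPt R e 1 y (-e) ∈ τ) :
      ∃ w ∈ capsule R, IsWitness (sliverSites R e x y N) w τ := by
    refine h.isWitness_witnessPt hN hτ (a := 0) (b := 0) (c := -z) e0 (by ring)
      (fun p hp => ?_) fun p hp q hq hqτ => ?_
    all_goals
      rcases hmem p hp with rfl | rfl | rfl | rfl <;> first
      | contradiction
      | simp only [dist_witnessPt_sliverPt, dist_witnessPt_topPt]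
        linarith
      | rcases mem_sliver.1 hq with rfl | rfl | rfl | rfl <;> first
        | contradiction
        | simp only [dist_witnessPt_sliverPt]
          linarith
  have w12 (h1 : sliverPt R e 1 (-y) e ∈ τ) (h2 : sliverPt R e (-1) (-y) (-e) ∈ τ)
      (h3 : sliverPt R e (-1) y e ∉ τ) (h4 : sliverPt R e 1 y (-e) ∉ τ) :
      ∃ w ∈ capsule R, IsWitness (sliverSites R e x y N) w τ := by
    refine h.isWitness_witnessPt hN hτ (a := 0) (b := -z) (c := 0) e0 (by ring)
      (fun p hp => ?_) fun p hp q hq hqτ => ?_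
    all_goals
      rcases hmem p hp with rfl | rfl | rfl | rfl <;> first
      | contradiction
      | simp only [dist_witnessPt_sliverPt, dist_witnessPt_topPt]
        linarith
      | rcases mem_sliver.1 hq with rfl | rfl | rfl | rfl <;> first
        | contradiction
        | simp only [dist_witnessPt_sliverPt]
          linarith
  have w34 (h3 : sliverPt R e (-1) y e ∈ τ) (h4 : sliverPt R e 1 y (-e) ∈ τ)
      (h1 : sliverPt R e 1 (-y) e ∉ τ) (h2 : sliverPt R e (-1) (-y) (-e) ∉ τ) :
      ∃ w ∈ capsule R, IsWitness (sliverSites R e x y N) w τ := by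
    refine h.isWitness_witnessPt hN hτ (a := 0) (b := z) (c := 0) e0 (by ring)
      (fun p hp => ?_) fun p hp q hq hqτ => ?_
    all_goals
      rcases hmem p hp with rfl | rfl | rfl | rfl <;> first
      | contradiction
      | simp only [dist_witnessPt_sliverPt, dist_witnessPt_topPt]
        linarith
      | rcases mem_sliver.1 hq with rfl | rfl | rfl | rfl <;> first
        | contradiction
        | simp only [dist_witnessPt_sliverPt]
          linarith
  have w14 (h1 : sliverPt R e 1 (-y) e ∈ τ) (h4 : sliverPt R e 1 y (-e) ∈ τ)
      (h2 : sliverPt R e (-1) (-y) (-e) ∉ τ) (h3 : sliverPt R e (-1) y e ∉ τ) :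
      ∃ w ∈ capsule R, IsWitness (sliverSites R e x y N) w τ := by
    -- A shift in the flat direction does not lower the point, so `c = z` supplies the descent; `a =
    -- e * z` exactly cancels the bias of `c` between the fourth and third vertices, and a tie
    -- suffices.
    refine h.isWitness_witnessPt hN hτ (a := e * z) (b := 0) (c := z) e1 (by ring)
      (fun p hp => ?_) fun p hp q hq hqτ => ?_
    all_goals
      rcases hmem p hp with rfl | rfl | rfl | rfl <;> first
      | contradiction
      | simp only [dist_witnessPt_sliverPt, dist_witnessPt_topPt]
        linarith
      | rcases mem_sliver.1 hq with rfl | rfl | rfl | rfl <;> first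
        | contradiction
        | simp only [dist_witnessPt_sliverPt]
          linarith
  have w23 (h2 : sliverPt R e (-1) (-y) (-e) ∈ τ) (h3 : sliverPt R e (-1) y e ∈ τ)
      (h1 : sliverPt R e 1 (-y) e ∉ τ) (h4 : sliverPt R e 1 y (-e) ∉ τ) :
      ∃ w ∈ capsule R, IsWitness (sliverSites R e x y N) w τ := by
    refine h.isWitness_witnessPt hN hτ (a := -(e * z)) (b := 0) (c := z) e2 (by ring)
      (fun p hp => ?_) fun p hp q hq hqτ => ?_
    all_goals
      rcases hmem p hp with rfl | rfl | rfl | rfl <;> first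
      | contradiction
      | simp only [dist_witnessPt_sliverPt, dist_witnessPt_topPt]
        linarith
      | rcases mem_sliver.1 hq with rfl | rfl | rfl | rfl <;> first
        | contradiction
        | simp only [dist_witnessPt_sliverPt]
          linarith
  by_cases h1 : sliverPt R e 1 (-y) e ∈ τ <;> by_cases h2 : sliverPt R e (-1) (-y) (-e) ∈ τ <;>
  by_cases h3 : sliverPt R e (-1) y e ∈ τ <;> by_cases h4 : sliverPt R e 1 y (-e) ∈ τ <;> first
  | exact w13 h1 h3
  | exact w24 h2 h4
  | exact w12 h1 h2 h3 h4
  | exact w34 h3 h4 h1 h2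
  | exact w14 h1 h4 h2 h3
  | exact w23 h2 h3 h1 h4
  | obtain ⟨p, hp⟩ := hne
    refine hsingle hp fun q hq => ?_
    rcases hmem p hp with rfl | rfl | rfl | rfl <;> rcases hmem q hq with rfl | rfl | rfl | rfl <;>
    first | rfl | contradiction

end IsSliver

end

/-! ### Choice of scale and assembly. -/

theorem mainTheorem3 :
    ∃ a b : ℝ, 0 < a ∧ 0 < b ∧
      ∀ μ ν : ℝ, 0 < μ → μ < 1 / 3 → 0 < ν → ν < 1 / 3 →
        ∃ (M L : Set (EuclideanSpace ℝ (Fin 4))) (ρ : ℝ),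
          IsCompact M ∧ IsC1Hypersurface M ∧
          0 < ρ ∧ reach M = ENNReal.ofReal ρ ∧
          L.Finite ∧ IsSparse L (a * (μ * ρ)) ∧ IsSample L M (b * (μ * ρ)) ∧
          ∀ η : ℝ, 0 < η →
            (∃ W : Set (EuclideanSpace ℝ (Fin 4)), W.Finite ∧
              IsSample W M (ν * ρ) ∧ IsSample W M η ∧
              ¬ witnessComplex W L ≤ restrictedDelaunay M L) ∧
            (∃ W : Set (EuclideanSpace ℝ (Fin 4)), W.Infinite ∧
              IsSample W M (ν * ρ) ∧ IsSample W M η ∧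
              ¬ witnessComplex W L ≤ restrictedDelaunay M L) := by
  refine ⟨1 / 2, 5, by norm_num, by norm_num, fun μ ν hμ hμ' hν _ => ?_⟩
  have hR : 3 < 1 / μ := by
    rw [lt_div_iff₀ hμ]
    linarith
  have hμR : μ * (1 / μ) = 1 := mul_one_div_cancel hμ.ne'
  set R := 1 / μ
  have hR0 : 0 < R := by linarith
  obtain ⟨e, x, y, z, h⟩ := exists_isSliver hR
  -- Keeping `N` at distance `3` from the apex leaves a hole that contains the near sites, which are
  -- within `3 / 2`; this gives sparsity `1 / 2` and covering radius at most `3 + 3 / 2 < 5`.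
  obtain ⟨N, hNS, hNfin, hNsep, hNcov⟩ := exists_finite_separated_net
    (S := {p ∈ capsule R | 3 ≤ dist p (apex R)}) (r := 1 / 2)
    ((isCompact_capsule R).totallyBounded.subset fun p hp => hp.1) (by norm_num)
  have hfar : ∀ q ∈ N, 3 ≤ dist q (apex R) := fun q hq => (hNS hq).2
  have hcov : ∀ p ∈ capsule R, 3 ≤ dist p (apex R) → ∃ q ∈ N, dist p q ≤ 1 / 2 :=
    fun p hp hp' => hNcov p ⟨hp, hp'⟩
  have hDel := h.sliver_notMem_restrictedDelaunay hcov
  have hWit := h.sliver_mem_witnessComplex hfar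
  refine ⟨capsule R, sliverSites R e x y N, R, isCompact_capsule R, isC1Hypersurface_capsule hR0,
    hR0, reach_capsule hR0, (finite_singleton _).union ((Finset.finite_toSet _).union hNfin),
    ?_, ?_, fun η hη => ⟨?_, ?_⟩⟩
  · rw [hμR, mul_one]
    exact h.isSparse_sliverSites hfar hNsep
  · rw [hμR, mul_one]
    exact isSample_of_forall_exists_dist_le (h.sliverSites_subset fun q hq => (hNS hq).1)
      fun p hp => h.exists_dist_sliverSites_le hcov hp
  · obtain ⟨W, hW, hWM, hσ⟩ := exists_finite_isSample_mem_witnessComplex (isCompact_capsule R)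
      hWit (r := min (ν * R) η) (lt_min (mul_pos hν hR0) hη)
    exact ⟨W, hW, hWM.mono (min_le_left _ _), hWM.mono (min_le_right _ _),
      fun hle => hDel (hle hσ)⟩
  · exact ⟨capsule R, infinite_capsule R, isSample_self _ (mul_pos hν hR0).le,
      isSample_self _ hη.le, fun hle => hDel (hle hWit)⟩
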